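/- Let $N\ge 2$ and let $f_1,f_2,g:\mathbb R^N\to\mathbb R$ be measurable. For $u\in H^1(\mathbb R^N)$ put $u^+=\max\{u,0\}$, $u^-=\max\{-u,0\}$ and consider the two-phase functional $$J(u)=\int_{\mathbb R^N}\Big(|\nabla u|^2-2f_1u^+-2f_2u^-+g^2\chi_{\{u\neq0\}}\Big)\,dx$$ and, for $f\in\{f_1,f_2\}$, the one-phase functional $$J^1_{\{f,g\}}(u)=\int_{\mathbb R^N}\Big(|\nabla u|^2-2fu+g^2\chi_{\{u>0\}}\Big)\,dx ,$$ where an integral is given the value $+\infty$ if its integrand is not integrable (for bounded data such that $f_1$ and $f_2$ have compactly supported positive parts, this is the usual value of $J(u)$ for every $u\in H^1(\mathbb R^N)$, and of $J^1_{\{f,g\}}(u)$ for every $u\ge 0$ in $H^1(\mathbb R^N)$). Suppose that $J$ has a minimizer $u$ over $H^1(\mathbb R^N)$ whose phases $\Omega^\pm=\{x:\pm u(x)>0\}$ are nonempty. Let $U^1\ge0$ minimize $J^1_{\{f_1,g\}}(\varphi)$ over $\{\varphi\in H^1(\mathbb R^N):\varphi\ge0\}$ and let $u^1\le 0$ minimize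 $J^1_{\{f_2,g\}}(-\varphi)$ over $\{\varphi\in H^1(\mathbb R^N):\varphi\le0\}$. Then: 1. If $U^1$ is the largest one-phase minimizer, that is, $W\le U^1$ a.e. for every minimizer $W$ of the first one-phase problem (in particular, if that minimizer is unique), then $\Omega^+\subseteq\{U^1>0\}$. 2. If $u^1$ is the smallest minimizer of the second one-phase problem, that is, $u^1\le w$ a.e. for every minimizer $w$ of that problem (in particular, if that minimizer is unique), then $\Omega^-\subseteq\{u^1<0\}$. 3. For arbitrary one-phase minimizers $U^1$ and $u^1$, the truncation $\tilde u=\max\{u^1,\min\{u,U^1\}\}$ is again a minimizer of $J$ over $H^1(\mathbb R^N)$, and $\{\tilde u>0\}\subseteq\{U^1>0\}$, $\{\tilde u<0\}\subseteq\{u^1<0\}$. The inclusions hold up to null sets; those in 1 and 2 hold everywhere if the two functions compared are continuous. -/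

import Mathlib

open MeasureTheory Filter
open scoped ContDiff

noncomputable section

namespace TwoPhase

/-- The space `ℝ^N` with its Euclidean norm and Lebesgue measure. -/
abbrev Space (N : ℕ) : Type := EuclideanSpace ℝ (Fin N)

/-- `G` is a weak (distributional) gradient of `u`: one has `∫ u ∇φ = -∫ φ G` for all test
functions `φ ∈ C_c^∞(ℝ^N)`. It is used below for square integrable `u` and `G` only, where both
integrals converge. -/
def IsWeakGradient {N : ℕ} (u : Space N → ℝ) (G : Space N → Space N) : Prop :=
  ∀ φ : Space N → ℝ, ContDiff ℝ ∞ φ → HasCompactSupport φ →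
    ∫ x, u x • gradient φ x = -∫ x, φ x • G x

/-- `u ∈ H¹(ℝ^N)`: `u` is square integrable with a square integrable weak gradient. Functions are
representatives; all definitions below depend only on the class of `u` modulo null sets. -/
def MemH1 {N : ℕ} (u : Space N → ℝ) : Prop :=
  MemLp u 2 volume ∧ ∃ G : Space N → Space N, MemLp G 2 volume ∧ IsWeakGradient u G

open Classical in
/-- The weak gradient of a function of class `H¹` (it is unique up to null sets). -/
def weakGrad {N : ℕ} (u : Space N → ℝ) : Space N → Space N :=
  if h : ∃ G : Space N → Space N, MemLp G 2 volume ∧ IsWeakGradient u G then h.choose else 0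

open Classical in
/-- The value in `(-∞, +∞]` of an energy with density `F`: the integral if `F` is integrable, and
`+∞` otherwise. -/
def energyIntegral {N : ℕ} (F : Space N → ℝ) : EReal :=
  if Integrable F volume then ((∫ x, F x : ℝ) : EReal) else ⊤

/-- The two-phase functional
`J(u) = ∫ |∇u|² - 2 f₁ u⁺ - 2 f₂ u⁻ + g² χ_{u ≠ 0}`,
with `u⁺ = max u 0` and `u⁻ = max (-u) 0`. -/
def twoPhaseEnergy {N : ℕ} (f₁ f₂ g : Space N → ℝ) (u : Space N → ℝ) : EReal :=
  energyIntegral fun x =>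
    ‖weakGrad u x‖ ^ 2 - 2 * f₁ x * max (u x) 0 - 2 * f₂ x * max (-u x) 0
      + {y | u y ≠ 0}.indicator (fun y => g y ^ 2) x

/-- The one-phase functional `J¹(u) = ∫ |∇u|² - 2 f u + g² χ_{u > 0}`. -/
def onePhaseEnergy {N : ℕ} (f g : Space N → ℝ) (u : Space N → ℝ) : EReal :=
  energyIntegral fun x =>
    ‖weakGrad u x‖ ^ 2 - 2 * f x * u x + {y | 0 < u y}.indicator (fun y => g y ^ 2) x

/-- `u` minimizes the two-phase functional over `H¹(ℝ^N)`. -/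
def IsTwoPhaseMinimizer {N : ℕ} (f₁ f₂ g : Space N → ℝ) (u : Space N → ℝ) : Prop :=
  MemH1 u ∧ ∀ φ : Space N → ℝ, MemH1 φ → twoPhaseEnergy f₁ f₂ g u ≤ twoPhaseEnergy f₁ f₂ g φ

/-- `U ≥ 0` minimizes the one-phase functional `J¹` over `{φ ∈ H¹(ℝ^N) : φ ≥ 0}`. -/
def IsPosMinimizer {N : ℕ} (f g : Space N → ℝ) (U : Space N → ℝ) : Prop :=
  MemH1 U ∧ (∀ᵐ x, 0 ≤ U x) ∧
    ∀ φ : Space N → ℝ, MemH1 φ → (∀ᵐ x, 0 ≤ φ x) → onePhaseEnergy f g U ≤ onePhaseEnergy f g φ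

/-- `v ≤ 0` minimizes `φ ↦ J¹(-φ)` over `{φ ∈ H¹(ℝ^N) : φ ≤ 0}`. -/
def IsNegMinimizer {N : ℕ} (f g : Space N → ℝ) (v : Space N → ℝ) : Prop :=
  MemH1 v ∧ (∀ᵐ x, v x ≤ 0) ∧
    ∀ φ : Space N → ℝ, MemH1 φ → (∀ᵐ x, φ x ≤ 0) → onePhaseEnergy f g (-v) ≤ onePhaseEnergy f g (-φ)

end TwoPhase

end

/-!
Let `u` minimize the two-phase functional `J`, let `U ≥ 0` minimize the one-phase functional `J¹`
with data `f₁`, and put `m = min u U`, `M = max u U`. Off the set `A = {U < u}` one has `m = u` and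
`M = U`; on `A` the roles are exchanged, and there both `u` and `U` are nonnegative, so that the
densities of `J` and `J¹` agree. Hence `J m - J u = J¹ U - J¹ M`. The left side is nonnegative and
the right side nonpositive by minimality, so `m` minimizes `J` and `M` minimizes `J¹`
(`IsTwoPhaseMinimizer.min_and_max`). If `U` is the largest one-phase minimizer, then
`u ≤ M ≤ U` a.e., which is the inclusion of the positive phases. The negative phase follows by the
reflection `u ↦ -u`, which exchanges `f₁` and `f₂`; cutting `u` first from above by `U` and then
from below by `v` gives the statement on the truncation.

The analytic input is that `H¹` is stable under minima and maxima, with the expected weak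
gradients (`MemH1.max_and_weakGrad`, `MemH1.min_and_weakGrad`). It reduces to the formula
`∇ w⁺ = χ_{w > 0} ∇ w` (`IsWeakDeriv.max_zero`), a limit of the chain rule for `C¹` functions
(`IsWeakDeriv.comp_of_hasDerivAt`). The latter is proved by mollification. Mollifications converge
a.e. by the Lebesgue differentiation theorem, and they are dominated by the mollifications of the
absolute values, whose integrals do not change; so a dominated convergence theorem with varying
bounds (`tendsto_integral_of_tendsto_bound`) permits the passage to the limit.
-/

namespace TwoPhase

open Topology ContinuousLinearMap
open scoped Convolution

/-! ### Dominated convergence with varying bounds -/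

/-- Nonnegative functions that converge a.e. together with their integrals converge in `L¹`
(Scheffé's lemma). -/
theorem tendsto_integral_abs_sub_of_tendsto_integral {α : Type*} [MeasurableSpace α]
    {μ : Measure α} {b : ℕ → α → ℝ} {B : α → ℝ} (hb : ∀ n, Integrable (b n) μ)
    (hB : Integrable B μ) (hnn : ∀ n x, 0 ≤ b n x)
    (hlim : ∀ᵐ x ∂μ, Tendsto (fun n => b n x) atTop (𝓝 (B x)))
    (hint : Tendsto (fun n => ∫ x, b n x ∂μ) atTop (𝓝 (∫ x, B x ∂μ))) :
    Tendsto (fun n => ∫ x, |b n x - B x| ∂μ) atTop (𝓝 0) := by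
  -- `|b - B| = (b - B) + 2 (B - b)⁺`, and `(B - b)⁺ ≤ |B|` is dominated.
  have h1 : Tendsto (fun n => ∫ x, max (B x - b n x) 0 ∂μ) atTop (𝓝 (∫ _, (0 : ℝ) ∂μ)) := by
    refine tendsto_integral_of_dominated_convergence (fun x => |B x|)
      (fun n => ((hB.sub (hb n)).pos_part).aestronglyMeasurable) hB.abs (fun n => ?_) ?_
    · refine Eventually.of_forall fun x => ?_
      rw [Real.norm_eq_abs, abs_of_nonneg (le_max_right _ _)]
      exact max_le (by linarith [hnn n x, le_abs_self (B x)]) (abs_nonneg _)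
    · filter_upwards [hlim] with x hx
      simpa using ((tendsto_const_nhds (x := B x)).sub hx).max (tendsto_const_nhds (x := (0 : ℝ)))
  have h2 := (hint.sub_const (∫ x, B x ∂μ)).add (h1.const_mul 2)
  simp only [sub_self, integral_zero, mul_zero, add_zero] at h2
  refine h2.congr fun n => ?_
  have hi1 : Integrable (fun x => b n x - B x) μ := (hb n).sub hB
  have hi2 : Integrable (fun x => 2 * max (B x - b n x) 0) μ :=
    (hB.sub (hb n)).pos_part.const_mul 2
  rw [← integral_sub (hb n) hB, ← integral_const_mul, ← integral_add hi1 hi2]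
  refine integral_congr_ae (Eventually.of_forall fun x => ?_)
  simp only
  rcases le_total (b n x) (B x) with h | h
  · rw [max_eq_left (by linarith), abs_of_nonpos (by linarith)]; ring
  · rw [max_eq_right (by linarith), abs_of_nonneg (by linarith)]; ring

/-- Dominated convergence where the bounds vary, but converge together with their integrals
(Pratt's lemma). -/
theorem tendsto_integral_of_tendsto_bound {α : Type*} [MeasurableSpace α]
    {μ : Measure α} {b f : ℕ → α → ℝ} {B F : α → ℝ} (hb : ∀ n, Integrable (b n) μ)
    (hB : Integrable B μ) (hnn : ∀ n x, 0 ≤ b n x)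
    (hlim : ∀ᵐ x ∂μ, Tendsto (fun n => b n x) atTop (𝓝 (B x)))
    (hint : Tendsto (fun n => ∫ x, b n x ∂μ) atTop (𝓝 (∫ x, B x ∂μ)))
    (hf : ∀ n, AEStronglyMeasurable (f n) μ) (hle : ∀ n, ∀ᵐ x ∂μ, |f n x| ≤ b n x)
    (hflim : ∀ᵐ x ∂μ, Tendsto (fun n => f n x) atTop (𝓝 (F x))) :
    Tendsto (fun n => ∫ x, f n x ∂μ) atTop (𝓝 (∫ x, F x ∂μ)) := by
  -- Truncation at the limiting bound `B` costs at most `|b - B|`.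
  have hfi : ∀ n, Integrable (f n) μ := fun n => (hb n).mono' (hf n) (hle n)
  have hgm : ∀ n, AEStronglyMeasurable (fun x => max (-B x) (min (f n x) (B x))) μ :=
    fun n => hB.aestronglyMeasurable.neg.sup ((hf n).inf hB.aestronglyMeasurable)
  have hgB : ∀ n, ∀ᵐ x ∂μ, ‖max (-B x) (min (f n x) (B x))‖ ≤ |B x| := fun n =>
    Eventually.of_forall fun x => by
      rw [Real.norm_eq_abs]
      refine abs_le.2 ⟨(neg_le_neg (le_abs_self _)).trans (le_max_left _ _),
        max_le (neg_le_abs _) ((min_le_right _ _).trans (le_abs_self _))⟩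
  have h1 : Tendsto (fun n => ∫ x, max (-B x) (min (f n x) (B x)) ∂μ) atTop
      (𝓝 (∫ x, F x ∂μ)) := by
    refine tendsto_integral_of_dominated_convergence _ hgm hB.abs hgB ?_
    filter_upwards [hlim, hflim, ae_all_iff.2 hle] with x hx hfx hlex
    have hF : |F x| ≤ B x := le_of_tendsto_of_tendsto' hfx.abs hx hlex
    have := (tendsto_const_nhds (x := -B x)).max (hfx.min (tendsto_const_nhds (x := B x)))
    rwa [min_eq_left (abs_le.1 hF).2, max_eq_right (abs_le.1 hF).1] at this
  have h2 := tendsto_integral_abs_sub_of_tendsto_integral hb hB hnn hlim hint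
  have h3 : Tendsto (fun n => ∫ x, (f n x - max (-B x) (min (f n x) (B x))) ∂μ) atTop (𝓝 0) := by
    refine squeeze_zero_norm (fun n => ?_) h2
    refine norm_integral_le_of_norm_le ((hb n).sub hB).abs ?_
    have hB0 : ∀ᵐ x ∂μ, 0 ≤ B x := by
      filter_upwards [hlim] with x hx using ge_of_tendsto' hx fun n => hnn n x
    filter_upwards [hle n, hB0] with x hx h0
    have hx' := abs_le.1 hx
    rw [Real.norm_eq_abs]
    have := le_abs_self (b n x - B x)
    have := abs_nonneg (b n x - B x)
    refine abs_le.2 ⟨?_, ?_⟩ <;>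
    rcases max_cases (-B x) (min (f n x) (B x)) with ⟨h, _⟩ | ⟨h, _⟩ <;>
    rcases min_cases (f n x) (B x) with ⟨h', _⟩ | ⟨h', _⟩ <;> linarith
  have h4 := h1.add h3
  rw [add_zero] at h4
  refine h4.congr fun n => ?_
  have hi1 : Integrable (fun x => max (-B x) (min (f n x) (B x))) μ := hB.mono (hgm n) (hgB n)
  have hi2 : Integrable (fun x => f n x - max (-B x) (min (f n x) (B x))) μ := (hfi n).sub hi1
  rw [← integral_add hi1 hi2]
  simp

/-! ### Weak directional derivatives and mollification -/

variable {E : Type*} [NormedAddCommGroup E] [NormedSpace ℝ E]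

/-- The standard mollifiers: the `n`-th bump function is supported in the ball of radius
`1 / (n + 1)`. -/
noncomputable def mollifier (E : Type*) [NormedAddCommGroup E] [NormedSpace ℝ E] (n : ℕ) :
    ContDiffBump (0 : E) where
  rIn := 1 / (n + 1) / 2
  rOut := 1 / (n + 1)
  rIn_pos := by positivity
  rIn_lt_rOut := half_lt_self (by positivity)

theorem mollifier_rOut_le_one (n : ℕ) : (mollifier E n).rOut ≤ 1 := by
  change 1 / ((n : ℝ) + 1) ≤ 1
  rw [div_le_one (by positivity)]
  linarith [n.cast_nonneg (α := ℝ)]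

variable [MeasurableSpace E]

/-- `G` is a weak derivative of `w` in the direction `v`. -/
def IsWeakDeriv (μ : Measure E) (v : E) (w G : E → ℝ) : Prop :=
  ∀ φ : E → ℝ, ContDiff ℝ ∞ φ → HasCompactSupport φ →
    ∫ x, w x * fderiv ℝ φ x v ∂μ = -∫ x, φ x * G x ∂μ

variable [BorelSpace E] [FiniteDimensional ℝ E] {μ : Measure E} [μ.IsAddHaarMeasure]

/-- The convolution of `H` with the `n`-th mollifier. -/
noncomputable def mollify (μ : Measure E) [μ.IsAddHaarMeasure] (n : ℕ) (H : E → ℝ) : E → ℝ :=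
  (mollifier E n).normed μ ⋆[lsmul ℝ ℝ, μ] H

theorem mollify_apply (n : ℕ) (H : E → ℝ) (x : E) :
    mollify μ n H x = ∫ t, (mollifier E n).normed μ (x - t) * H t ∂μ :=
  convolution_eq_swap (lsmul ℝ ℝ)

theorem integrable_mollify {H : E → ℝ} (hH : Integrable H μ) (n : ℕ) :
    Integrable (mollify μ n H) μ :=
  ((mollifier E n).integrable_normed).integrable_convolution (lsmul ℝ ℝ) hH

theorem integral_mollify {H : E → ℝ} (hH : Integrable H μ) (n : ℕ) :
    ∫ x, mollify μ n H x ∂μ = ∫ x, H x ∂μ := by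
  have := integral_convolution (μ := μ) (ν := μ) (lsmul ℝ ℝ : ℝ →L[ℝ] ℝ →L[ℝ] ℝ)
    (mollifier E n).integrable_normed hH
  rw [(mollifier E n).integral_normed] at this
  exact this.trans (one_mul _)

theorem abs_mollify_le (H : E → ℝ) (n : ℕ) (x : E) :
    |mollify μ n H x| ≤ mollify μ n (fun y => |H y|) x := by
  rw [mollify_apply, mollify_apply]
  refine (abs_integral_le_integral_abs).trans (le_of_eq ?_)
  refine integral_congr_ae (Eventually.of_forall fun t => ?_)
  simp only [abs_mul, abs_of_nonneg ((mollifier E n).nonneg_normed _)]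

theorem ae_tendsto_mollify {H : E → ℝ} (hH : Integrable H μ) :
    ∀ᵐ x ∂μ, Tendsto (fun n => mollify μ n H x) atTop (𝓝 (H x)) := by
  refine ContDiffBump.ae_convolution_tendsto_right_of_locallyIntegrable (K := 2)
    (φ := mollifier E) tendsto_one_div_add_atTop_nhds_zero_nat
    (Eventually.of_forall fun n => ?_) hH.locallyIntegrable
  simp only [mollifier]
  linarith

theorem contDiff_mollify {H : E → ℝ} (hH : Integrable H μ) (n : ℕ) :
    ContDiff ℝ 1 (mollify μ n H) :=
  ((mollifier E n).hasCompactSupport_normed).contDiff_convolution_left (n := 1) (lsmul ℝ ℝ)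
    (mollifier E n).contDiff_normed hH.locallyIntegrable

/-- Dominated convergence with the mollifications of an integrable function as bounds; these
converge a.e. and keep their integral, so that Pratt's lemma applies. -/
theorem tendsto_integral_of_abs_le_mollify {H : E → ℝ} (hH : Integrable H μ) {C : ℝ} (hC : 0 ≤ C)
    {f : ℕ → E → ℝ} {F : E → ℝ} (hf : ∀ n, AEStronglyMeasurable (f n) μ)
    (hle : ∀ n x, |f n x| ≤ C * mollify μ n (fun y => |H y|) x)
    (hflim : ∀ᵐ x ∂μ, Tendsto (fun n => f n x) atTop (𝓝 (F x))) :
    Tendsto (fun n => ∫ x, f n x ∂μ) atTop (𝓝 (∫ x, F x ∂μ)) := by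
  refine tendsto_integral_of_tendsto_bound (b := fun n x => C * mollify μ n (fun y => |H y|) x)
    (B := fun x => C * |H x|) (fun n => (integrable_mollify hH.abs n).const_mul C)
    (hH.abs.const_mul C) (fun n x => mul_nonneg hC ?_) ?_ ?_ hf
    (fun n => Eventually.of_forall (hle n)) hflim
  · exact (abs_nonneg _).trans (abs_mollify_le H n x)
  · filter_upwards [ae_tendsto_mollify hH.abs] with x hx using hx.const_mul C
  · simp only [integral_const_mul, integral_mollify hH.abs]
    exact tendsto_const_nhds

/-- At points whose unit ball lies in `B`, the derivative of the mollification of `w` cut off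
outside `B` is the mollification of the weak derivative, cut off in the same way: the translated
mollifier is an admissible test function. -/
theorem hasLineDerivAt_mollify_indicator {v : E} {w G : E → ℝ} (hw : LocallyIntegrable w μ)
    (hwG : IsWeakDeriv μ v w G) {B : Set E} (hB : IsCompact B)
    {x : E} (hx : Metric.closedBall x 1 ⊆ B) (n : ℕ) :
    HasLineDerivAt ℝ (mollify μ n (B.indicator w)) (mollify μ n (B.indicator G) x) x v := by
  have hwB : LocallyIntegrable (B.indicator w) μ :=
    ((hw.integrableOn_isCompact hB).integrable_indicator hB.measurableSet).locallyIntegrable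
  have hcs := (mollifier E n).hasCompactSupport_normed (μ := μ)
  have hsm : ContDiff ℝ ∞ ((mollifier E n).normed μ) := (mollifier E n).contDiff_normed
  have hd := (hcs.hasFDerivAt_convolution_left (lsmul ℝ ℝ)
    (hsm.of_le (by simp)) hwB x).hasLineDerivAt v
  have hcd : Continuous (fderiv ℝ ((mollifier E n).normed μ)) := hsm.continuous_fderiv (by simp)
  have hex := (hcs.fderiv (𝕜 := ℝ)).convolutionExists_left (μ := μ)
    ((lsmul ℝ ℝ : ℝ →L[ℝ] ℝ →L[ℝ] ℝ).precompL E) hcd hwB x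
  convert hd using 1
  · rfl
  rw [convolution_eq_swap, ContinuousLinearMap.integral_apply hex.integrable_swap]
  have hsupp : ∀ t ∉ B, x - t ∉ tsupport ((mollifier E n).normed μ) := by
    intro t ht h
    rw [(mollifier E n).tsupport_normed_eq] at h
    refine ht (hx ?_)
    rw [mem_closedBall_zero_iff] at h
    rw [Metric.mem_closedBall, dist_comm, dist_eq_norm]
    exact h.trans (mollifier_rOut_le_one n)
  have hfd : ∀ t, fderiv ℝ (fun y => (mollifier E n).normed μ (x - y)) t v
      = -fderiv ℝ ((mollifier E n).normed μ) (x - t) v := fun t => by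
    have h := ((hsm.differentiable (by simp)) (x - t)).hasFDerivAt.comp t
      ((hasFDerivAt_id (𝕜 := ℝ) t).const_sub x)
    have h' : fderiv ℝ (fun y => (mollifier E n).normed μ (x - y)) t = _ := h.fderiv
    simp [h']
  have key := hwG (fun y => (mollifier E n).normed μ (x - y)) (hsm.comp (by fun_prop))
    (hcs.comp_homeomorph (Homeomorph.subLeft x))
  simp only [hfd, mul_neg, integral_neg, neg_inj] at key
  rw [mollify_apply]
  calc _ = ∫ t, (mollifier E n).normed μ (x - t) * G t ∂μ := by
        refine integral_congr_ae (Eventually.of_forall fun t => ?_)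
        by_cases ht : t ∈ B
        · simp [ht]
        · simp [ht, image_eq_zero_of_notMem_tsupport (hsupp t ht)]
    _ = _ := by
        rw [← key]
        refine integral_congr_ae (Eventually.of_forall fun t => ?_)
        by_cases ht : t ∈ B
        · simp [ht, precompL_apply, mul_comm]
        · have : fderiv ℝ ((mollifier E n).normed μ) (x - t) = 0 :=
            image_eq_zero_of_notMem_tsupport fun h => hsupp t ht (tsupport_fderiv_subset ℝ h)
          simp [ht, this]

/-! ### The chain rule -/

/-- The chain rule for `C¹` functions. It is integration by parts for the mollifications of a
cutoff of `w`; the limit is taken with Pratt's lemma, whose bounds are mollifications of the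
absolute values. -/
theorem IsWeakDeriv.comp_of_hasDerivAt {v : E} {w G : E → ℝ} (hw : LocallyIntegrable w μ)
    (hG : LocallyIntegrable G μ) (hwG : IsWeakDeriv μ v w G) {F F' : ℝ → ℝ}
    (hF : ∀ t, HasDerivAt F (F' t) t) (hF' : Continuous F') (hF0 : ∀ t, |F t| ≤ |t|)
    (hF'1 : ∀ t, |F' t| ≤ 1) :
    IsWeakDeriv μ v (fun x => F (w x)) (fun x => F' (w x) * G x) := by
  intro φ hφ hφc
  have hFc : Continuous F := continuous_iff_continuousAt.2 fun t => (hF t).continuousAt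
  -- Only the values of `w` and `G` at distance at most `1` from the support of `φ` matter.
  set B : Set E := Metric.cthickening 1 (tsupport φ) with hBdef
  have hBc : IsCompact B := hφc.isCompact.cthickening
  have hballs : ∀ x ∈ tsupport φ, Metric.closedBall x 1 ⊆ B := fun x hx =>
    Metric.closedBall_subset_cthickening hx 1
  have hsub : tsupport φ ⊆ B := Metric.self_subset_cthickening _
  have hwB : Integrable (B.indicator w) μ :=
    (hw.integrableOn_isCompact hBc).integrable_indicator hBc.measurableSet
  have hGB : Integrable (B.indicator G) μ :=
    (hG.integrableOn_isCompact hBc).integrable_indicator hBc.measurableSet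
  have hdc : Continuous fun x => fderiv ℝ φ x v :=
    (hφ.continuous_fderiv (by simp)).clm_apply continuous_const
  obtain ⟨C, hC⟩ := hφ.continuous.bounded_above_of_compact_support hφc
  obtain ⟨D, hD⟩ := hdc.bounded_above_of_compact_support (hφc.fderiv_apply (𝕜 := ℝ) v)
  have hC0 : 0 ≤ C := (norm_nonneg _).trans (hC 0)
  have hD0 : 0 ≤ D := (norm_nonneg _).trans (hD 0)
  have hwn : ∀ n, Continuous (mollify μ n (B.indicator w)) := fun n =>
    (contDiff_mollify hwB n).continuous
  have hGn : ∀ n, Continuous (mollify μ n (B.indicator G)) := fun n =>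
    (contDiff_mollify hGB n).continuous
  have hfd0 : ∀ x ∉ B, fderiv ℝ φ x = 0 := fun x hx =>
    image_eq_zero_of_notMem_tsupport fun h => hx (hsub (tsupport_fderiv_subset ℝ h))
  have hφ0 : ∀ x ∉ B, φ x = 0 := fun x hx =>
    image_eq_zero_of_notMem_tsupport fun h => hx (hsub h)
  have hcs1 : ∀ h : E → ℝ, HasCompactSupport fun x => h x * φ x := fun h => hφc.mul_left
  have parts : ∀ n, ∫ x, F (mollify μ n (B.indicator w) x) * fderiv ℝ φ x v ∂μ
      = -∫ x, F' (mollify μ n (B.indicator w) x) * mollify μ n (B.indicator G) x * φ x ∂μ := by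
    intro n
    refine integral_bilinear_hasLineDerivAt_right_eq_neg_left_of_integrable (v := v)
      (f := fun x => F (mollify μ n (B.indicator w) x))
      (f' := fun x => F' (mollify μ n (B.indicator w) x) * mollify μ n (B.indicator G) x)
      (g := φ) (g' := fun x => fderiv ℝ φ x v) (B := ContinuousLinearMap.mul ℝ ℝ)
      ?_ ?_ ?_ (fun x hx => ?_) (fun x _ => ?_)
    · exact Continuous.integrable_of_hasCompactSupport
        (((hF'.comp (hwn n)).mul (hGn n)).mul hφ.continuous) (hcs1 _)
    · exact Continuous.integrable_of_hasCompactSupport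
        ((hFc.comp (hwn n)).mul hdc) ((hφc.fderiv_apply (𝕜 := ℝ) v).mul_left)
    · exact Continuous.integrable_of_hasCompactSupport
        ((hFc.comp (hwn n)).mul hφ.continuous) (hcs1 _)
    · have h1 := hasLineDerivAt_mollify_indicator hw hwG hBc (hballs x hx) n
      have h2 : HasDerivAt F (F' (mollify μ n (B.indicator w) x))
        (mollify μ n (B.indicator w) (x + (0 : ℝ) • v)) := by simpa using hF _
      exact h2.comp (0 : ℝ) h1
    · exact ((hφ.differentiable (by simp)) x).hasFDerivAt.hasLineDerivAt v
  have lim1 : Tendsto (fun n => ∫ x, F (mollify μ n (B.indicator w) x) * fderiv ℝ φ x v ∂μ) atTop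
      (𝓝 (∫ x, F (B.indicator w x) * fderiv ℝ φ x v ∂μ)) := by
    refine tendsto_integral_of_abs_le_mollify hwB hD0
      (fun n => ((hFc.comp (hwn n)).mul hdc).aestronglyMeasurable) (fun n x => ?_) ?_
    · rw [abs_mul, mul_comm]
      exact mul_le_mul (hD x) ((hF0 _).trans (abs_mollify_le _ _ _)) (abs_nonneg _) hD0
    · filter_upwards [ae_tendsto_mollify hwB] with x hx
      exact ((hFc.tendsto _).comp hx).mul_const _
  have lim2 : Tendsto (fun n => ∫ x, F' (mollify μ n (B.indicator w) x)
      * mollify μ n (B.indicator G) x * φ x ∂μ) atTop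
      (𝓝 (∫ x, F' (B.indicator w x) * B.indicator G x * φ x ∂μ)) := by
    refine tendsto_integral_of_abs_le_mollify hGB hC0
      (fun n => (((hF'.comp (hwn n)).mul (hGn n)).mul hφ.continuous).aestronglyMeasurable)
      (fun n x => ?_) ?_
    · rw [abs_mul, abs_mul, mul_comm]
      refine mul_le_mul (hC x) ?_ (by positivity) hC0
      calc _ ≤ 1 * |mollify μ n (B.indicator G) x| := by gcongr; exact hF'1 _
        _ ≤ _ := by rw [one_mul]; exact abs_mollify_le _ _ _
    · filter_upwards [ae_tendsto_mollify hwB, ae_tendsto_mollify hGB] with x hx hx'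
      exact (((hF'.tendsto _).comp hx).mul hx').mul_const _
  have hlim := tendsto_nhds_unique lim1 (lim2.neg.congr fun n => (parts n).symm)
  calc _ = ∫ x, F (B.indicator w x) * fderiv ℝ φ x v ∂μ := by
        refine integral_congr_ae (Eventually.of_forall fun x => ?_)
        by_cases hx : x ∈ B
        · simp [hx]
        · simp [hfd0 x hx]
    _ = _ := by
        rw [hlim]
        congr 1
        refine integral_congr_ae (Eventually.of_forall fun x => ?_)
        by_cases hx : x ∈ B
        · simp [hx, mul_comm]
        · simp [hφ0 x hx]

/-- A `C¹` approximation of `t ↦ max t 0`: the primitive, vanishing at `0`, of a smooth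
approximation of the Heaviside function. -/
noncomputable def smoothPosPart (k : ℕ) (t : ℝ) : ℝ :=
  ∫ s in (0 : ℝ)..t, Real.smoothTransition (k * s)

theorem hasDerivAt_smoothPosPart (k : ℕ) (t : ℝ) :
    HasDerivAt (smoothPosPart k) (Real.smoothTransition (k * t)) t := by
  have hc : Continuous fun s : ℝ => Real.smoothTransition (k * s) :=
    Real.smoothTransition.continuous.comp (by fun_prop)
  exact (hc.integral_hasStrictDerivAt 0 t).hasDerivAt

theorem abs_smoothTransition_le_one (t : ℝ) : |Real.smoothTransition t| ≤ 1 := by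
  rw [abs_of_nonneg (Real.smoothTransition.nonneg t)]
  exact Real.smoothTransition.le_one t

theorem abs_smoothPosPart_le (k : ℕ) (t : ℝ) : |smoothPosPart k t| ≤ |t| := by
  have := intervalIntegral.norm_integral_le_of_norm_le_const (a := 0) (b := t) (C := 1)
    (f := fun s : ℝ => Real.smoothTransition (k * s))
    fun s _ => abs_smoothTransition_le_one _
  simpa [smoothPosPart] using this

theorem tendsto_smoothTransition_mul (t : ℝ) :
    Tendsto (fun k : ℕ => Real.smoothTransition (k * t)) atTop (𝓝 (if 0 < t then 1 else 0)) := by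
  split_ifs with ht
  · refine tendsto_const_nhds.congr' ?_
    filter_upwards [(tendsto_natCast_atTop_atTop.atTop_mul_const ht).eventually_ge_atTop 1]
      with k hk using (Real.smoothTransition.one_of_one_le hk).symm
  · refine tendsto_const_nhds.congr fun k => ?_
    exact (Real.smoothTransition.zero_of_nonpos
      (mul_nonpos_of_nonneg_of_nonpos k.cast_nonneg (not_lt.1 ht))).symm

theorem tendsto_smoothPosPart (t : ℝ) :
    Tendsto (fun k => smoothPosPart k t) atTop (𝓝 (max t 0)) := by
  have h : Tendsto (fun k => smoothPosPart k t) atTop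
      (𝓝 (∫ s in (0 : ℝ)..t, if 0 < s then (1 : ℝ) else 0)) := by
    refine intervalIntegral.tendsto_integral_filter_of_dominated_convergence (fun _ => 1)
      (Eventually.of_forall fun k => ?_) (Eventually.of_forall fun k => ?_)
      intervalIntegrable_const ?_
    · exact (Real.smoothTransition.continuous.comp (by fun_prop)).aestronglyMeasurable
    · exact Eventually.of_forall fun s _ => abs_smoothTransition_le_one _
    · exact Eventually.of_forall fun s _ => tendsto_smoothTransition_mul s
  convert h using 2
  rcases le_total 0 t with ht | ht
  · rw [max_eq_left ht, intervalIntegral.integral_of_le ht,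
      setIntegral_congr_fun (g := fun _ => (1 : ℝ)) measurableSet_Ioc fun s hs => if_pos hs.1]
    simp [ht]
  · rw [max_eq_right ht, intervalIntegral.integral_of_ge ht,
      setIntegral_congr_fun (g := fun _ => (0 : ℝ)) measurableSet_Ioc
        fun s hs => if_neg (not_lt.2 hs.2)]
    simp

/-- The weak derivative of the positive part, from the chain rule for `smoothPosPart k` as
`k → ∞`. No information on `G` over `{w = 0}` is needed, since the derivatives of the
approximations vanish at `0`. -/
theorem IsWeakDeriv.max_zero {v : E} {w G : E → ℝ} (hw : LocallyIntegrable w μ)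
    (hG : LocallyIntegrable G μ) (hwG : IsWeakDeriv μ v w G) :
    IsWeakDeriv μ v (fun x => max (w x) 0) (fun x => if 0 < w x then G x else 0) := by
  intro φ hφ hφc
  have hdc : Continuous fun x => fderiv ℝ φ x v :=
    (hφ.continuous_fderiv (by simp)).clm_apply continuous_const
  have hwi : Integrable (fun x => w x * fderiv ℝ φ x v) μ :=
    hw.integrable_smul_right_of_hasCompactSupport hdc (hφc.fderiv_apply (𝕜 := ℝ) v)
  have hGi : Integrable (fun x => φ x * G x) μ :=
    hG.integrable_smul_left_of_hasCompactSupport hφ.continuous hφc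
  have hFc : ∀ k, Continuous (smoothPosPart k) := fun k =>
    continuous_iff_continuousAt.2 fun t => (hasDerivAt_smoothPosPart k t).continuousAt
  have hF'c : ∀ k : ℕ, Continuous fun t : ℝ => Real.smoothTransition (k * t) := fun k =>
    Real.smoothTransition.continuous.comp (by fun_prop)
  have lim1 : Tendsto (fun k => ∫ x, smoothPosPart k (w x) * fderiv ℝ φ x v ∂μ) atTop
      (𝓝 (∫ x, max (w x) 0 * fderiv ℝ φ x v ∂μ)) := by
    refine tendsto_integral_of_dominated_convergence _ (fun k => ?_) hwi.norm (fun k => ?_) ?_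
    · exact ((hFc k).comp_aestronglyMeasurable hw.aestronglyMeasurable).mul
        hdc.aestronglyMeasurable
    · refine Eventually.of_forall fun x => ?_
      rw [norm_mul, norm_mul]
      gcongr
      exact abs_smoothPosPart_le k _
    · exact Eventually.of_forall fun x => (tendsto_smoothPosPart _).mul_const _
  have lim2 : Tendsto (fun k : ℕ => ∫ x, φ x * (Real.smoothTransition (k * w x) * G x) ∂μ) atTop
      (𝓝 (∫ x, φ x * (if 0 < w x then G x else 0) ∂μ)) := by
    refine tendsto_integral_of_dominated_convergence _ (fun k => ?_) hGi.norm (fun k => ?_) ?_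
    · exact hφ.continuous.aestronglyMeasurable.mul
        (((hF'c k).comp_aestronglyMeasurable hw.aestronglyMeasurable).mul
          hG.aestronglyMeasurable)
    · refine Eventually.of_forall fun x => ?_
      rw [norm_mul, norm_mul, norm_mul]
      gcongr
      exact mul_le_of_le_one_left (norm_nonneg _) (abs_smoothTransition_le_one _)
    · refine Eventually.of_forall fun x => ?_
      have := ((tendsto_smoothTransition_mul (w x)).mul_const (G x)).const_mul (φ x)
      simpa only [ite_mul, one_mul, zero_mul] using this
  refine tendsto_nhds_unique lim1 (lim2.neg.congr fun k => ?_)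
  exact (hwG.comp_of_hasDerivAt hw hG (hasDerivAt_smoothPosPart k) (hF'c k)
    (abs_smoothPosPart_le k) (fun t => abs_smoothTransition_le_one _) φ hφ hφc).symm

/-! ### Weak gradients of functions of class `H¹` -/

variable {N : ℕ} {u w U : Space N → ℝ} {G H : Space N → Space N}

theorem memLp_two_locallyIntegrable {F : Type*} [NormedAddCommGroup F] {f : Space N → F}
    (hf : MemLp f 2 volume) : LocallyIntegrable f volume :=
  hf.locallyIntegrable (by norm_num)

theorem memLp_indicator {S : Set (Space N)} (hG : MemLp G 2 volume)
    (hS : NullMeasurableSet S volume) : MemLp (S.indicator G) 2 volume :=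
  hG.of_le (hG.aestronglyMeasurable.indicator₀ hS)
    (Eventually.of_forall fun x => norm_indicator_le_norm_self G x)

theorem memLp_inner {v : Space N} (hG : MemLp G 2 volume) :
    MemLp (fun x => inner ℝ v (G x)) 2 volume :=
  (innerSL ℝ v).comp_memLp' hG

theorem continuous_gradient {φ : Space N → ℝ} (hφ : ContDiff ℝ ∞ φ) : Continuous (gradient φ) :=
  (InnerProductSpace.toDual ℝ (Space N)).symm.continuous.comp (hφ.continuous_fderiv (by simp))

theorem hasCompactSupport_gradient {φ : Space N → ℝ} (hφ : HasCompactSupport φ) :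
    HasCompactSupport (gradient φ) :=
  (hφ.fderiv (𝕜 := ℝ)).comp_left (g := (InnerProductSpace.toDual ℝ (Space N)).symm) (map_zero _)

theorem integrable_smul_gradient (hu : LocallyIntegrable u volume) {φ : Space N → ℝ}
    (hφ : ContDiff ℝ ∞ φ) (hφc : HasCompactSupport φ) :
    Integrable (fun x => u x • gradient φ x) volume :=
  hu.integrable_smul_right_of_hasCompactSupport (continuous_gradient hφ)
    (hasCompactSupport_gradient hφc)

theorem integrable_smul_of_contDiff (hG : LocallyIntegrable G volume) {φ : Space N → ℝ}
    (hφ : ContDiff ℝ ∞ φ) (hφc : HasCompactSupport φ) :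
    Integrable (fun x => φ x • G x) volume :=
  hG.integrable_smul_left_of_hasCompactSupport hφ.continuous hφc

/-- A weak gradient is tested componentwise. -/
theorem isWeakGradient_iff_isWeakDeriv (hu : LocallyIntegrable u volume)
    (hG : LocallyIntegrable G volume) :
    IsWeakGradient u G ↔
      ∀ v, IsWeakDeriv volume v u (fun x => inner ℝ v (G x)) := by
  have h1 : ∀ φ : Space N → ℝ, ContDiff ℝ ∞ φ → HasCompactSupport φ → ∀ v,
      inner ℝ v (∫ x, u x • gradient φ x) = ∫ x, u x * fderiv ℝ φ x v := by
    intro φ hφ hφc v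
    rw [← integral_inner (integrable_smul_gradient hu hφ hφc)]
    refine integral_congr_ae (Eventually.of_forall fun x => ?_)
    simp only
    rw [inner_smul_right, real_inner_comm, gradient, InnerProductSpace.toDual_symm_apply]
  have h2 : ∀ φ : Space N → ℝ, ContDiff ℝ ∞ φ → HasCompactSupport φ → ∀ v,
      inner ℝ v (-∫ x, φ x • G x) = -∫ x, φ x * inner ℝ v (G x) := by
    intro φ hφ hφc v
    rw [inner_neg_right, ← integral_inner (integrable_smul_of_contDiff hG hφ hφc)]
    simp only [inner_smul_right]
  constructor
  · intro h v φ hφ hφc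
    rw [← h1 φ hφ hφc, ← h2 φ hφ hφc, h φ hφ hφc]
  · intro h φ hφ hφc
    refine ext_inner_left ℝ fun v => ?_
    rw [h1 φ hφ hφc, h2 φ hφ hφc, h v φ hφ hφc]

/-- Uniqueness of the weak gradient. -/
theorem IsWeakGradient.ae_eq (hG : MemLp G 2 volume) (hH : MemLp H 2 volume)
    (h : IsWeakGradient u G) (h' : IsWeakGradient u H) : G =ᵐ[volume] H := by
  have hGl := memLp_two_locallyIntegrable hG
  have hHl := memLp_two_locallyIntegrable hH
  have := ae_eq_zero_of_integral_contDiff_smul_eq_zero (f := G - H) (hGl.sub hHl) fun φ hφ hφc => by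
    have e := (h φ hφ hφc).symm.trans (h' φ hφ hφc)
    simp only [Pi.sub_apply, smul_sub]
    rw [integral_sub (integrable_smul_of_contDiff hGl hφ hφc)
      (integrable_smul_of_contDiff hHl hφ hφc), neg_inj.1 e, sub_self]
  filter_upwards [this] with x hx using sub_eq_zero.1 hx

theorem IsWeakGradient.add (hu : LocallyIntegrable u volume) (hw : LocallyIntegrable w volume)
    (hG : LocallyIntegrable G volume) (hH : LocallyIntegrable H volume)
    (h : IsWeakGradient u G) (h' : IsWeakGradient w H) : IsWeakGradient (u + w) (G + H) := by
  intro φ hφ hφc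
  simp only [Pi.add_apply, add_smul, smul_add]
  rw [integral_add (integrable_smul_gradient hu hφ hφc) (integrable_smul_gradient hw hφ hφc),
    integral_add (integrable_smul_of_contDiff hG hφ hφc) (integrable_smul_of_contDiff hH hφ hφc),
    h φ hφ hφc, h' φ hφ hφc, neg_add]

theorem IsWeakGradient.neg (h : IsWeakGradient u G) : IsWeakGradient (-u) (-G) := by
  intro φ hφ hφc
  simp only [Pi.neg_apply, neg_smul, smul_neg, integral_neg, h φ hφ hφc]

theorem IsWeakGradient.max_zero (hu : MemLp u 2 volume) (hG : MemLp G 2 volume)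
    (h : IsWeakGradient u G) :
    IsWeakGradient (fun x => max (u x) 0) ({x | 0 < u x}.indicator G) := by
  have hul := memLp_two_locallyIntegrable hu
  have hGl := memLp_two_locallyIntegrable hG
  have hS : NullMeasurableSet {x | 0 < u x} volume :=
    nullMeasurableSet_lt aemeasurable_const hu.aestronglyMeasurable.aemeasurable
  rw [isWeakGradient_iff_isWeakDeriv (memLp_two_locallyIntegrable hu.pos_part)
    (memLp_two_locallyIntegrable (memLp_indicator hG hS))]
  intro v
  convert ((isWeakGradient_iff_isWeakDeriv hul hGl).1 h v).max_zero hul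
    (memLp_two_locallyIntegrable (memLp_inner hG)) using 2 with x
  by_cases hx : 0 < u x <;> simp [hx]

theorem MemH1.memLp_weakGrad (h : MemH1 u) : MemLp (weakGrad u) 2 volume := by
  rw [weakGrad, dif_pos h.2]
  exact h.2.choose_spec.1

theorem MemH1.isWeakGradient_weakGrad (h : MemH1 u) : IsWeakGradient u (weakGrad u) := by
  rw [weakGrad, dif_pos h.2]
  exact h.2.choose_spec.2

theorem weakGrad_ae_eq (hG : MemLp G 2 volume) (h : IsWeakGradient u G) :
    weakGrad u =ᵐ[volume] G := by
  have hex : ∃ G : Space N → Space N, MemLp G 2 volume ∧ IsWeakGradient u G := ⟨G, hG, h⟩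
  rw [weakGrad, dif_pos hex]
  exact hex.choose_spec.2.ae_eq hex.choose_spec.1 hG h

theorem MemH1.neg (h : MemH1 u) : MemH1 (-u) :=
  ⟨h.1.neg, _, h.memLp_weakGrad.neg, h.isWeakGradient_weakGrad.neg⟩

theorem MemH1.weakGrad_neg (h : MemH1 u) : weakGrad (-u) =ᵐ[volume] -weakGrad u :=
  weakGrad_ae_eq h.memLp_weakGrad.neg h.isWeakGradient_weakGrad.neg

theorem isWeakGradient_zero : IsWeakGradient (0 : Space N → ℝ) 0 := fun φ _ _ => by simp

theorem memH1_zero : MemH1 (0 : Space N → ℝ) := ⟨MemLp.zero, 0, MemLp.zero, isWeakGradient_zero⟩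

theorem weakGrad_zero : weakGrad (0 : Space N → ℝ) =ᵐ[volume] 0 :=
  weakGrad_ae_eq MemLp.zero isWeakGradient_zero

/-- The weak gradient of a maximum, from `max u U = U + (u - U)⁺`. -/
theorem MemH1.max_and_weakGrad (hu : MemH1 u) (hU : MemH1 U) :
    MemH1 (fun x => max (u x) (U x)) ∧
      weakGrad (fun x => max (u x) (U x)) =ᵐ[volume]
        {x | U x < u x}.indicator (weakGrad u) + {x | U x < u x}ᶜ.indicator (weakGrad U) := by
  have hd : MemLp (u + -U) 2 volume := hu.1.add hU.1.neg
  have hdG : MemLp (weakGrad u + -weakGrad U) 2 volume :=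
    hu.memLp_weakGrad.add hU.memLp_weakGrad.neg
  have hdW : IsWeakGradient (u + -U) (weakGrad u + -weakGrad U) :=
    hu.isWeakGradient_weakGrad.add (memLp_two_locallyIntegrable hu.1)
      (memLp_two_locallyIntegrable hU.1.neg) (memLp_two_locallyIntegrable hu.memLp_weakGrad)
      (memLp_two_locallyIntegrable hU.memLp_weakGrad.neg) hU.isWeakGradient_weakGrad.neg
  have hS : NullMeasurableSet {x | 0 < (u + -U) x} volume :=
    nullMeasurableSet_lt aemeasurable_const hd.aestronglyMeasurable.aemeasurable
  have hsum := hU.isWeakGradient_weakGrad.add (memLp_two_locallyIntegrable hU.1)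
    (memLp_two_locallyIntegrable hd.pos_part) (memLp_two_locallyIntegrable hU.memLp_weakGrad)
    (memLp_two_locallyIntegrable (memLp_indicator hdG hS)) (hdW.max_zero hd hdG)
  have hGm := hU.memLp_weakGrad.add (memLp_indicator hdG hS)
  have e1 : (U + fun x => max ((u + -U) x) 0) = fun x => max (u x) (U x) := by
    funext x
    simp only [Pi.add_apply, Pi.neg_apply]
    rw [← max_add_add_left]
    simp
  have e2 : weakGrad U + {x | 0 < (u + -U) x}.indicator (weakGrad u + -weakGrad U)
      = {x | U x < u x}.indicator (weakGrad u) + {x | U x < u x}ᶜ.indicator (weakGrad U) := by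
    funext x
    by_cases hx : U x < u x <;> simp [Set.indicator, hx]
  rw [e1, e2] at hsum
  rw [e2] at hGm
  refine ⟨⟨?_, _, hGm, hsum⟩, weakGrad_ae_eq hGm hsum⟩
  rw [← e1]
  exact hU.1.add hd.pos_part

/-- The weak gradient of a minimum, from `min u U = -max (-U) (-u)`. -/
theorem MemH1.min_and_weakGrad (hu : MemH1 u) (hU : MemH1 U) :
    MemH1 (fun x => min (u x) (U x)) ∧
      weakGrad (fun x => min (u x) (U x)) =ᵐ[volume]
        {x | U x < u x}.indicator (weakGrad U) + {x | U x < u x}ᶜ.indicator (weakGrad u) := by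
  have e : (fun x => min (u x) (U x)) = -fun x => max ((-U) x) ((-u) x) := by
    funext x
    simp only [Pi.neg_apply]
    rw [max_neg_neg, neg_neg, min_comm]
  obtain ⟨h, hG⟩ := hU.neg.max_and_weakGrad hu.neg
  rw [e]
  refine ⟨h.neg, ?_⟩
  filter_upwards [h.weakGrad_neg, hG, hu.weakGrad_neg, hU.weakGrad_neg] with x h1 h2 h3 h4
  rw [h1, Pi.neg_apply, h2]
  by_cases hx : U x < u x <;> simp [Set.indicator, hx, h3, h4]

/-! ### Energies -/

theorem energyIntegral_congr {F F' : Space N → ℝ} (h : F =ᵐ[volume] F') :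
    energyIntegral F = energyIntegral F' := by
  have hi : Integrable F volume ↔ Integrable F' volume := integrable_congr h
  by_cases hF : Integrable F volume
  · rw [energyIntegral, energyIntegral, if_pos hF, if_pos (hi.1 hF), integral_congr_ae h]
  · rw [energyIntegral, energyIntegral, if_neg hF, if_neg (mt hi.2 hF)]

theorem energyIntegral_of_integrable {F : Space N → ℝ} (h : Integrable F volume) :
    energyIntegral F = ((∫ x, F x : ℝ) : EReal) := if_pos h

theorem integrable_of_energyIntegral_le_zero {F : Space N → ℝ} (h : energyIntegral F ≤ 0) :
    Integrable F volume := by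
  by_contra hF
  rw [energyIntegral, if_neg hF] at h
  simp at h

variable {f f₁ f₂ g : Space N → ℝ}

/-- The density of the two-phase functional. -/
noncomputable def twoPhaseDensity (f₁ f₂ g u : Space N → ℝ) (x : Space N) : ℝ :=
  ‖weakGrad u x‖ ^ 2 - 2 * f₁ x * max (u x) 0 - 2 * f₂ x * max (-u x) 0
    + {y | u y ≠ 0}.indicator (fun y => g y ^ 2) x

/-- The density of the one-phase functional. -/
noncomputable def onePhaseDensity (f g u : Space N → ℝ) (x : Space N) : ℝ :=
  ‖weakGrad u x‖ ^ 2 - 2 * f x * u x + {y | 0 < u y}.indicator (fun y => g y ^ 2) x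

theorem twoPhaseEnergy_eq : twoPhaseEnergy f₁ f₂ g u = energyIntegral (twoPhaseDensity f₁ f₂ g u) :=
  rfl

theorem onePhaseEnergy_eq : onePhaseEnergy f g u = energyIntegral (onePhaseDensity f g u) := rfl

theorem twoPhaseEnergy_zero : twoPhaseEnergy f₁ f₂ g 0 = 0 := by
  have h : twoPhaseDensity f₁ f₂ g 0 =ᵐ[volume] 0 := by
    filter_upwards [weakGrad_zero (N := N)] with x hx
    simp [twoPhaseDensity, hx]
  rw [twoPhaseEnergy_eq, energyIntegral_congr h,
    energyIntegral_of_integrable (integrable_zero _ _ _)]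
  simp

theorem onePhaseEnergy_zero : onePhaseEnergy f g 0 = 0 := by
  have h : onePhaseDensity f g 0 =ᵐ[volume] 0 := by
    filter_upwards [weakGrad_zero (N := N)] with x hx
    simp [onePhaseDensity, hx]
  rw [onePhaseEnergy_eq, energyIntegral_congr h,
    energyIntegral_of_integrable (integrable_zero _ _ _)]
  simp

/-- For a nonnegative function the two functionals have the same density. -/
theorem twoPhaseDensity_eq_onePhaseDensity {x : Space N} (hx : 0 ≤ u x) :
    twoPhaseDensity f₁ f₂ g u x = onePhaseDensity f₁ g u x := by
  simp [twoPhaseDensity, onePhaseDensity, Set.indicator, hx, hx.lt_iff_ne']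

/-- The densities at a point depend only on the value and the weak gradient there. -/
theorem twoPhaseDensity_congr {x : Space N} (h : u x = w x) (h' : weakGrad u x = weakGrad w x) :
    twoPhaseDensity f₁ f₂ g u x = twoPhaseDensity f₁ f₂ g w x := by
  simp [twoPhaseDensity, Set.indicator, h, h']

theorem onePhaseDensity_congr {x : Space N} (h : u x = w x) (h' : weakGrad u x = weakGrad w x) :
    onePhaseDensity f g u x = onePhaseDensity f g w x := by
  simp [onePhaseDensity, Set.indicator, h, h']

/-- The exchange argument. On the set `{U < u}` the two competitors swap their densities, so the
energy gained by `min u U` over `u` is the energy lost by `max u U` over `U`. Both are nonnegative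
by minimality, so they vanish. The swap is exact because `0 ≤ U < u` on this set, where the two
densities agree. -/
theorem IsTwoPhaseMinimizer.min_and_max (hu : IsTwoPhaseMinimizer f₁ f₂ g u)
    (hU : IsPosMinimizer f₁ g U) :
    IsTwoPhaseMinimizer f₁ f₂ g (fun x => min (u x) (U x)) ∧
      IsPosMinimizer f₁ g (fun x => max (u x) (U x)) := by
  obtain ⟨hm, hmG⟩ := hu.1.min_and_weakGrad hU.1
  obtain ⟨hM, hMG⟩ := hu.1.max_and_weakGrad hU.1
  have hM0 : ∀ᵐ x, 0 ≤ max (u x) (U x) := by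
    filter_upwards [hU.2.1] with x hx using hx.trans (le_max_right _ _)
  -- Comparison with `0` excludes the value `+∞`.
  have iu : Integrable (twoPhaseDensity f₁ f₂ g u) volume :=
    integrable_of_energyIntegral_le_zero ((hu.2 0 memH1_zero).trans_eq twoPhaseEnergy_zero)
  have iU : Integrable (onePhaseDensity f₁ g U) volume :=
    integrable_of_energyIntegral_le_zero ((hU.2.2 0 memH1_zero
      (Eventually.of_forall fun _ => le_rfl)).trans_eq onePhaseEnergy_zero)
  have hS : NullMeasurableSet {x | U x < u x} volume :=
    nullMeasurableSet_lt hU.1.1.aestronglyMeasurable.aemeasurable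
      hu.1.1.aestronglyMeasurable.aemeasurable
  set D : Space N → ℝ :=
    {x | U x < u x}.indicator (onePhaseDensity f₁ g U - twoPhaseDensity f₁ f₂ g u) with hD
  have iD : Integrable D volume := (iU.sub iu).indicator₀ hS
  have em : twoPhaseDensity f₁ f₂ g (fun x => min (u x) (U x))
      =ᵐ[volume] twoPhaseDensity f₁ f₂ g u + D := by
    filter_upwards [hmG, hU.2.1] with x hG h0
    by_cases hx : U x < u x
    · have h1 : min (u x) (U x) = U x := min_eq_right hx.le
      have h2 : weakGrad (fun x => min (u x) (U x)) x = weakGrad U x := by simp [hG, hx]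
      rw [twoPhaseDensity_congr (w := U) h1 h2, twoPhaseDensity_eq_onePhaseDensity h0]
      simp [hD, hx]
    · have h1 : min (u x) (U x) = u x := min_eq_left (not_lt.1 hx)
      have h2 : weakGrad (fun x => min (u x) (U x)) x = weakGrad u x := by simp [hG, hx]
      rw [twoPhaseDensity_congr (w := u) h1 h2]
      simp [hD, hx]
  have eM : onePhaseDensity f₁ g (fun x => max (u x) (U x))
      =ᵐ[volume] onePhaseDensity f₁ g U - D := by
    filter_upwards [hMG, hU.2.1] with x hG h0
    by_cases hx : U x < u x
    · have h1 : max (u x) (U x) = u x := max_eq_left hx.le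
      have h2 : weakGrad (fun x => max (u x) (U x)) x = weakGrad u x := by simp [hG, hx]
      rw [onePhaseDensity_congr (w := u) h1 h2,
        ← twoPhaseDensity_eq_onePhaseDensity (f₂ := f₂) (h0.trans hx.le)]
      simp [hD, hx]
    · have h1 : max (u x) (U x) = U x := max_eq_right (not_lt.1 hx)
      have h2 : weakGrad (fun x => max (u x) (U x)) x = weakGrad U x := by simp [hG, hx]
      rw [onePhaseDensity_congr (w := U) h1 h2]
      simp [hD, hx]
  have Jm : twoPhaseEnergy f₁ f₂ g (fun x => min (u x) (U x))
      = ((∫ x, twoPhaseDensity f₁ f₂ g u x) + ∫ x, D x : ℝ) := by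
    rw [twoPhaseEnergy_eq, energyIntegral_congr em, energyIntegral_of_integrable (iu.add iD)]
    simp only [Pi.add_apply]
    rw [integral_add iu iD]
  have JM : onePhaseEnergy f₁ g (fun x => max (u x) (U x))
      = ((∫ x, onePhaseDensity f₁ g U x) - ∫ x, D x : ℝ) := by
    rw [onePhaseEnergy_eq, energyIntegral_congr eM, energyIntegral_of_integrable (iU.sub iD)]
    simp only [Pi.sub_apply]
    rw [integral_sub iU iD]
  have Ju : twoPhaseEnergy f₁ f₂ g u = ((∫ x, twoPhaseDensity f₁ f₂ g u x : ℝ) : EReal) :=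
    energyIntegral_of_integrable iu
  have JU : onePhaseEnergy f₁ g U = ((∫ x, onePhaseDensity f₁ g U x : ℝ) : EReal) :=
    energyIntegral_of_integrable iU
  have D0 : ∫ x, D x = 0 := by
    have h1 := hu.2 _ hm
    have h2 := hU.2.2 _ hM hM0
    rw [Ju, Jm, EReal.coe_le_coe_iff] at h1
    rw [JU, JM, EReal.coe_le_coe_iff] at h2
    linarith
  rw [D0, add_zero, ← Ju] at Jm
  rw [D0, sub_zero, ← JU] at JM
  exact ⟨⟨hm, fun φ hφ => Jm ▸ hu.2 φ hφ⟩, hM, hM0, fun φ hφ h0 => JM ▸ hU.2.2 φ hφ h0⟩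

/-! ### Reflection -/

/-- Reflection `u ↦ -u` exchanges the two phases and hence `f₁` and `f₂`. -/
theorem twoPhaseEnergy_neg (hu : MemH1 u) :
    twoPhaseEnergy f₂ f₁ g (-u) = twoPhaseEnergy f₁ f₂ g u := by
  refine energyIntegral_congr ?_
  filter_upwards [hu.weakGrad_neg] with x hx
  simp only [hx, Pi.neg_apply, norm_neg, neg_neg, Set.indicator, Set.mem_ofPred_eq, neg_ne_zero]
  ring

theorem IsTwoPhaseMinimizer.neg (hu : IsTwoPhaseMinimizer f₁ f₂ g u) :
    IsTwoPhaseMinimizer f₂ f₁ g (-u) := by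
  refine ⟨hu.1.neg, fun φ hφ => ?_⟩
  rw [twoPhaseEnergy_neg hu.1, ← twoPhaseEnergy_neg hφ]
  exact hu.2 _ hφ.neg

theorem isPosMinimizer_neg_iff : IsPosMinimizer f g (-u) ↔ IsNegMinimizer f g u := by
  constructor
  · rintro ⟨h1, h2, h3⟩
    refine ⟨by simpa using h1.neg, by simpa using h2, fun φ hφ h0 => h3 _ hφ.neg (by simpa using h0)⟩
  · rintro ⟨h1, h2, h3⟩
    refine ⟨h1.neg, by simpa using h2, fun φ hφ h0 => ?_⟩
    simpa using h3 (-φ) hφ.neg (by simpa using h0)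

/-! ### Comparison of the phases -/

/-- The maximum `max u U` is a one-phase minimizer, hence below the largest one. -/
theorem IsTwoPhaseMinimizer.ae_le_of_largest (hu : IsTwoPhaseMinimizer f₁ f₂ g u)
    (hU : IsPosMinimizer f₁ g U) (hmax : ∀ W, IsPosMinimizer f₁ g W → ∀ᵐ x, W x ≤ U x) :
    ∀ᵐ x, u x ≤ U x := by
  filter_upwards [hmax _ (hu.min_and_max hU).2] with x hx using (le_max_left _ _).trans hx

theorem IsTwoPhaseMinimizer.pos_subset_of_largest (hu : IsTwoPhaseMinimizer f₁ f₂ g u)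
    (hU : IsPosMinimizer f₁ g U) (hmax : ∀ W, IsPosMinimizer f₁ g W → ∀ᵐ x, W x ≤ U x) :
    (∀ᵐ x, 0 < u x → 0 < U x) ∧
      (Continuous u → Continuous U → {x | 0 < u x} ⊆ {x | 0 < U x}) := by
  have hle := hu.ae_le_of_largest hU hmax
  refine ⟨?_, fun hcu hcU x hx => ?_⟩
  · filter_upwards [hle] with x hx h using h.trans_le hx
  · -- An a.e. inequality between continuous functions holds everywhere.
    have hd : Dense {x | u x ≤ U x} := Measure.dense_of_ae hle
    have huniv : {x | u x ≤ U x} = Set.univ :=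
      (isClosed_le hcu hcU).closure_eq.symm.trans hd.closure_eq
    have : x ∈ {x | u x ≤ U x} := huniv ▸ Set.mem_univ x
    exact lt_of_lt_of_le (show 0 < u x from hx) (show u x ≤ U x from this)

end TwoPhase

theorem mainTheorem12 (N : ℕ) (hN : 2 ≤ N)
    (f₁ f₂ g : TwoPhase.Space N → ℝ)
    (hf₁ : AEMeasurable f₁) (hf₂ : AEMeasurable f₂) (hg : AEMeasurable g)
    (u U v : TwoPhase.Space N → ℝ)
    (hu : TwoPhase.IsTwoPhaseMinimizer f₁ f₂ g u)
    (hpos : {x | 0 < u x}.Nonempty) (hneg : {x | u x < 0}.Nonempty)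
    (hU : TwoPhase.IsPosMinimizer f₁ g U) (hv : TwoPhase.IsNegMinimizer f₂ g v) :
    -- the positive phase, when `U` is the largest one-phase minimizer
    ((∀ W, TwoPhase.IsPosMinimizer f₁ g W → ∀ᵐ x, W x ≤ U x) →
      (∀ᵐ x, 0 < u x → 0 < U x) ∧
        (Continuous u → Continuous U → {x | 0 < u x} ⊆ {x | 0 < U x})) ∧
    -- the negative phase, when `v` is the one-phase minimizer with the largest negative part
    ((∀ w, TwoPhase.IsNegMinimizer f₂ g w → ∀ᵐ x, v x ≤ w x) →
      (∀ᵐ x, u x < 0 → v x < 0) ∧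
        (Continuous u → Continuous v → {x | u x < 0} ⊆ {x | v x < 0})) ∧
    -- arbitrary one-phase minimizers: `u` is truncated to a minimizer lying between them
    (TwoPhase.IsTwoPhaseMinimizer f₁ f₂ g (fun x => max (v x) (min (u x) (U x))) ∧
      (∀ᵐ x, 0 < max (v x) (min (u x) (U x)) → 0 < U x) ∧
      (∀ᵐ x, max (v x) (min (u x) (U x)) < 0 → v x < 0)) := by

  have hu' := hu.neg
  have hv' : TwoPhase.IsPosMinimizer f₂ g (-v) := TwoPhase.isPosMinimizer_neg_iff.2 hv
  refine ⟨hu.pos_subset_of_largest hU, fun hmin => ?_, ?_, ?_, ?_⟩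
  · obtain ⟨h1, h2⟩ := hu'.pos_subset_of_largest hv' fun W hW => by
      have hW' : TwoPhase.IsNegMinimizer f₂ g (-W) :=
        TwoPhase.isPosMinimizer_neg_iff.1 (by rwa [neg_neg])
      filter_upwards [hmin _ hW'] with x hx
      simp only [Pi.neg_apply] at hx ⊢
      linarith
    refine ⟨by simpa using h1, fun hcu hcv => ?_⟩
    simpa using h2 hcu.neg hcv.neg
  · -- `max v m = -min (-m) (-v)` with `m = min u U`.
    have h := ((hu.min_and_max hU).1.neg.min_and_max hv').1.neg
    convert h using 2 with x
    simp only [Pi.neg_apply]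
    rw [min_neg_neg, neg_neg, max_comm]
  · filter_upwards [hv.2.1] with x hx h
    rcases lt_max_iff.1 h with h | h
    · exact absurd h (not_lt.2 hx)
    · exact (lt_min_iff.1 h).2
  · exact Eventually.of_forall fun x h => (max_lt_iff.1 h).1
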